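/- Let $n\ge 1$ and $\sigma>0$. Let $H=H_{\sigma,1,\mathbb{C}^n}$ be the Hilbert space of holomorphic functions $f:\mathbb{C}^n\to\mathbb{C}$ with $$\|f\|^2=\frac{1}{(2\pi\sigma^2)^n}\int_{\mathbb{C}^n}|f(z)|^2e^{-\|z\|_2/\sigma}\,dV(z)<\infty ,$$ where $\|z\|_2$ is the Euclidean norm and $dV$ is Lebesgue measure on $\mathbb{C}^n\cong\mathbb{R}^{2n}$, with the corresponding inner product. $H$ is a reproducing kernel Hilbert space; let $K_z\in H$ be its reproducing kernel at $z\in\mathbb{C}^n$, so that $f(z)=\langle f,K_z\rangle$ for all $f\in H$. For a holomorphic map $\varphi:\mathbb{C}^n\to\mathbb{C}^n$ let $\mathcal{K}_\varphi f=f\circ\varphi$ be the Koopman (composition) operator with domain $\{f\in H: f\circ\varphi\in H\}$. It is called bounded over $H$ if its domain is all of $H$ and it is a bounded operator $H\to H$; in that case put $$\Pi_z(\varphi;\sigma)=\frac{\|\mathcal{K}_\varphi^*K_z\|^2}{\|K_z\|^2},\qquad z\in\mathbb{C}^n .$$ Theorem. Let $\varphi(z)=\mathcal{A}z+B$ with $\mathcal{A}\in\mathbb{C}^{n\times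 n}$ nonzero and invertible and $B\in\mathbb{C}^n$, and suppose that $\mathcal{K}_\varphi$ is bounded over $H$. Then $\mathcal{K}_\varphi$ is a compact operator on $H$ if and only if $\lim_{\|z\|_2\to\infty}\Pi_z(\varphi;\sigma)=0$. -/

import Mathlib

open MeasureTheory Filter Topology Metric Matrix

section
variable {E : Type*} [NormedAddCommGroup E] [NormedSpace ℂ E] [FiniteDimensional ℂ E]
  [MeasurableSpace E] [BorelSpace E] (μ : Measure E) [μ.IsAddHaarMeasure]

theorem measurePreserving_unit_smul (c : ℂ) (hc : ‖c‖ = 1) :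
    MeasurePreserving (fun w : E => c • w) μ μ := by
  have : FiniteDimensional ℝ E := FiniteDimensional.complexToReal E
  have : ProperSpace E := FiniteDimensional.proper ℂ E
  have hc0 : c ≠ 0 := by rintro rfl; simp at hc
  let L : E ≃L[ℂ] E := ContinuousLinearEquiv.smulLeft (Units.mk0 c hc0)
  have hL : ⇑L = fun w : E => c • w := rfl
  have : (μ.map L).IsAddHaarMeasure := L.isAddHaarMeasure_map μ
  have h := Measure.isAddLeftInvariant_eq_smul (μ.map L) μ
  refine ⟨by fun_prop, ?_⟩
  rw [← hL]
  have h1 : (μ.map L) (ball 0 1) = μ (ball 0 1) := by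
    rw [Measure.map_apply (by fun_prop) measurableSet_ball]
    congr 1
    ext w
    simp [hL, norm_smul, hc]
  rw [h] at h1 ⊢
  have h2 : μ (ball (0:E) 1) ≠ 0 := (measure_ball_pos μ 0 one_pos).ne'
  have h3 : μ (ball (0:E) 1) ≠ ⊤ := measure_ball_lt_top.ne
  set k := Measure.addHaarScalarFactor (μ.map L) μ
  have h4 : (k : ENNReal) = 1 := by
    rw [Measure.smul_apply, ENNReal.smul_def, smul_eq_mul] at h1
    exact (ENNReal.mul_eq_right h2 h3).1 h1
  have : k = 1 := by exact_mod_cast h4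
  rw [this, one_smul]

theorem integral_ball_of_differentiable {f : E → ℂ} (hf : Differentiable ℂ f) (z : E) :
    ∫ w in ball z 1, f w ∂μ = μ.real (ball z 1) * f z := by
  have : FiniteDimensional ℝ E := FiniteDimensional.complexToReal E
  have : ProperSpace E := FiniteDimensional.proper ℂ E
  have hfc := hf.continuous
  set B := ball (0 : E) 1 with hB
  have tr : ∀ g : E → ℂ, ∫ w in ball z 1, g w ∂μ = ∫ w in B, g (z + w) ∂μ := by
    intro g
    have := (measurePreserving_add_left μ z).setIntegral_preimage_emb
      (measurableEmbedding_addLeft z) g (ball z 1)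
    rw [← this]
    congr 2
    ext w; simp [hB]
  have hvol : μ.real (ball z 1) = μ.real B := by
    simp only [Measure.real, hB]; rw [Measure.addHaar_ball_center]
  rw [tr, hvol]
  have rot : ∀ θ : ℝ, ∫ w in B, f (z + circleMap 0 1 θ • w) ∂μ = ∫ w in B, f (z + w) ∂μ := by
    intro θ
    have hn : ‖circleMap 0 1 θ‖ = 1 := by simp
    have hc0 : circleMap 0 1 θ ≠ 0 := by intro h; simp [h] at hn
    have me : MeasurableEmbedding (fun w : E => circleMap 0 1 θ • w) :=
      (ContinuousLinearEquiv.smulLeft (R₁ := ℂ) (M₁ := E) (Units.mk0 _ hc0)).toHomeomorph.measurableEmbedding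
    have := (measurePreserving_unit_smul μ _ hn).setIntegral_preimage_emb me (fun w => f (z + w)) B
    rw [← this]
    congr 2
    ext w; simp [hB, norm_smul]
  have mean : ∀ w : E, ∫ θ in (0:ℝ)..2 * Real.pi, f (z + circleMap 0 1 θ • w)
      = (2 * Real.pi : ℝ) * f z := by
    intro w
    have hd : Differentiable ℂ (fun c : ℂ => f (z + c • w)) := by fun_prop
    have := (hd.diffContOnCl (s := ball (0:ℂ) |1|)).circleAverage
    rw [Real.circleAverage_def] at this
    simp only [zero_smul, add_zero] at this
    rw [← this, Complex.real_smul, ← mul_assoc, ← Complex.ofReal_mul,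
      mul_inv_cancel₀ (by positivity), Complex.ofReal_one, one_mul]
  have swap : ∫ θ in (0:ℝ)..2 * Real.pi, ∫ w in B, f (z + circleMap 0 1 θ • w) ∂μ
      = ∫ w in B, (∫ θ in (0:ℝ)..2 * Real.pi, f (z + circleMap 0 1 θ • w)) ∂μ := by
    refine MeasureTheory.intervalIntegral_integral_swap ?_
    rw [Measure.prod_restrict]
    have hcont : Continuous (Function.uncurry fun (θ : ℝ) (w : E) =>
        f (z + circleMap 0 1 θ • w)) := by
      have := (continuous_circleMap 0 1)
      unfold Function.uncurry
      fun_prop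
    have hK : IsCompact (Set.Icc 0 (2 * Real.pi) ×ˢ closedBall (0 : E) 1) :=
      isCompact_Icc.prod (isCompact_closedBall 0 1)
    refine (hcont.continuousOn.integrableOn_compact hK).mono_set (Set.prod_mono ?_ ?_)
    · rw [Set.uIoc_of_le (by positivity)]; exact Set.Ioc_subset_Icc_self
    · exact ball_subset_closedBall
  simp_rw [rot, mean] at swap
  rw [intervalIntegral.integral_const, integral_const] at swap
  simp only [sub_zero, measureReal_restrict_apply_univ, Complex.real_smul] at swap
  have h2 : ((2 * Real.pi : ℝ) : ℂ) ≠ 0 := by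
    exact_mod_cast (by positivity : (2 * Real.pi : ℝ) ≠ 0)
  apply mul_left_cancel₀ h2
  rw [swap]; ring

end

/-- The complex Euclidean space `ℂⁿ` with the norm `‖z‖₂ = √(|z₁|² + ⋯ + |zₙ|²)`. -/
abbrev Cn (n : ℕ) : Type := EuclideanSpace ℂ (Fin n)

namespace Laplace

/-- Lebesgue measure `dV` on `ℂⁿ ≅ ℝ²ⁿ`. -/
noncomputable def lebesgue (n : ℕ) : Measure (Cn n) :=
  (volume : Measure (Fin n → ℂ)).map (WithLp.toLp 2)

/-- The measure `(2πσ²)⁻ⁿ exp(-‖z‖₂/σ) dV(z)` on `ℂⁿ`. -/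
noncomputable def measure (n : ℕ) (σ : ℝ) : Measure (Cn n) :=
  (lebesgue n).withDensity
    fun z => ENNReal.ofReal (((2 * Real.pi * σ ^ 2) ^ n)⁻¹ * Real.exp (-‖z‖ / σ))

/-- The vector space of holomorphic functions `f : ℂⁿ → ℂ` that are square integrable with respect
to `(2πσ²)⁻ⁿ exp(-‖z‖₂/σ) dV(z)`. -/
def holomorphicL2 (n : ℕ) (σ : ℝ) : Submodule ℂ (Cn n → ℂ) where
  carrier := {f | Differentiable ℂ f ∧ MemLp f 2 (measure n σ)}
  add_mem' hf hg := ⟨hf.1.add hg.1, hf.2.add hg.2⟩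
  zero_mem' := ⟨differentiable_const 0, MemLp.zero⟩
  smul_mem' c _ hf := ⟨hf.1.const_smul c, hf.2.const_smul c⟩

/-- The space `H_{σ,1,ℂⁿ}`, for `σ > 0`. -/
def Space (n : ℕ) {σ : ℝ} (_hσ : 0 < σ) : Type := holomorphicL2 n σ

/-- An element of `H_{σ,1,ℂⁿ}` from a holomorphic function of finite norm. -/
def Space.of {n : ℕ} {σ : ℝ} (hσ : 0 < σ) (f : Cn n → ℂ) (hf : Differentiable ℂ f)
    (hf' : MemLp f 2 (measure n σ)) : Space n hσ :=
  (⟨f, And.intro hf hf'⟩ : holomorphicL2 n σ)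

instance lebesgue_isAddHaarMeasure (n : ℕ) : (lebesgue n).IsAddHaarMeasure :=
  (PiLp.continuousLinearEquiv 2 ℂ (fun _ : Fin n => ℂ)).symm.isAddHaarMeasure_map volume

section Space

variable {n : ℕ} {σ : ℝ} (hσ : 0 < σ)

noncomputable instance : AddCommGroup (Space n hσ) :=
  inferInstanceAs (AddCommGroup (holomorphicL2 n σ))

noncomputable instance : Module ℂ (Space n hσ) :=
  inferInstanceAs (Module ℂ (holomorphicL2 n σ))

theorem density_pos {σ : ℝ} (hσ : 0 < σ) (z : Cn n) :
    0 < ((2 * Real.pi * σ ^ 2) ^ n)⁻¹ * Real.exp (-‖z‖ / σ) := by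
  positivity

theorem lebesgue_absolutelyContinuous {σ : ℝ} (hσ : 0 < σ) : lebesgue n ≪ measure n σ := by
  refine withDensity_absolutelyContinuous' (by fun_prop) (Eventually.of_forall fun z => ?_)
  simpa using density_pos hσ z

theorem measure_absolutelyContinuous : measure n σ ≪ lebesgue n :=
  withDensity_absolutelyContinuous _ _

/-- The class in `L²` of an element of `H_{σ,1,ℂⁿ}`. -/
noncomputable def toLpₗ : Space n hσ →ₗ[ℂ] Lp ℂ 2 (measure n σ) where
  toFun f := MemLp.toLp f.1 f.2.2
  map_add' _ _ := rfl
  map_smul' _ _ := rfl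

theorem toLpₗ_injective : Function.Injective (toLpₗ (n := n) hσ) := by
  intro f g h
  have h1 : f.1 =ᵐ[measure n σ] g.1 := (MemLp.toLp_eq_toLp_iff f.2.2 g.2.2).1 h
  have h2 : f.1 =ᵐ[lebesgue n] g.1 := lebesgue_absolutelyContinuous hσ h1
  exact Subtype.ext (Continuous.ae_eq_iff_eq _ f.2.1.continuous g.2.1.continuous |>.1 h2)

noncomputable instance : NormedAddCommGroup (Space n hσ) :=
  NormedAddCommGroup.induced _ _ (toLpₗ hσ) (toLpₗ_injective hσ)

/-- The inner product of `H_{σ,1,ℂⁿ}` is that of `L²((2πσ²)⁻ⁿ exp(-‖z‖₂/σ) dV(z))`. -/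
noncomputable instance : InnerProductSpace ℂ (Space n hσ) :=
  InnerProductSpace.induced (toLpₗ hσ)

theorem inner_def (f g : Space n hσ) :
    inner ℂ f g = ∫ z, g.1 z * (starRingEnd ℂ) (f.1 z) ∂(measure n σ) := by
  change inner ℂ (toLpₗ hσ f) (toLpₗ hσ g) = _
  rw [L2.inner_def]
  refine integral_congr_ae ?_
  filter_upwards [f.2.2.coeFn_toLp, g.2.2.coeFn_toLp] with z hf hg
  change inner ℂ (MemLp.toLp f.1 f.2.2 z) (MemLp.toLp g.1 g.2.2 z) = _
  rw [hf, hg]; rfl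

theorem norm_sq_eq (f : Space n hσ) :
    ‖f‖ ^ 2 = ((2 * Real.pi * σ ^ 2) ^ n)⁻¹ *
      ∫ z, ‖f.1 z‖ ^ 2 * Real.exp (-‖z‖ / σ) ∂(lebesgue n) := by
  have h1 : ‖f‖ ^ 2 = ∫ z, ‖f.1 z‖ ^ 2 ∂(measure n σ) := by
    have := inner_self_eq_norm_sq_to_K (𝕜 := ℂ) f
    rw [inner_def] at this
    simp_rw [Complex.mul_conj, Complex.normSq_eq_norm_sq] at this
    have h2 : ∫ z, ((‖f.1 z‖ ^ 2 : ℝ) : ℂ) ∂(measure n σ)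
        = ((∫ z, ‖f.1 z‖ ^ 2 ∂(measure n σ) : ℝ) : ℂ) := integral_ofReal
    exact (Complex.ofReal_injective (by rw [← h2, this]; simp)).symm
  rw [h1, measure, integral_withDensity_eq_integral_toReal_smul (by fun_prop) (by simp),
    ← integral_const_mul]
  refine integral_congr_ae (Eventually.of_forall fun z => ?_)
  simp only [smul_eq_mul]
  rw [ENNReal.toReal_ofReal (density_pos hσ z).le]
  ring

/-- Point evaluations are bounded, uniformly on bounded sets. -/
theorem exists_eval_bound (R : ℝ) :
    ∃ C : ℝ, 0 ≤ C ∧ ∀ f : Space n hσ, ∀ z : Cn n, ‖z‖ ≤ R → ‖f.1 z‖ ≤ C * ‖f‖ := by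
  set V := (lebesgue n).real (ball (0 : Cn n) 1) with hV
  have hVpos : 0 < V := ENNReal.toReal_pos (measure_ball_pos _ _ one_pos).ne' measure_ball_lt_top.ne
  set N := ((2 * Real.pi * σ ^ 2) ^ n)⁻¹ with hN
  have hNpos : 0 < N := by positivity
  set m := Real.exp (-(R + 1) / σ) with hm
  have hmpos : 0 < m := Real.exp_pos _
  refine ⟨√(V⁻¹ * m⁻¹ * N⁻¹), Real.sqrt_nonneg _, fun f z hz => ?_⟩
  have hd : Differentiable ℂ (fun w => f.1 w ^ 2) := f.2.1.pow 2
  have hc := f.2.1.continuous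
  have h1 := integral_ball_of_differentiable (lebesgue n) hd z
  have hVz : (lebesgue n).real (ball z 1) = V := by
    simp only [Measure.real, hV]; rw [Measure.addHaar_ball_center]
  rw [hVz] at h1
  have h2 : V * ‖f.1 z‖ ^ 2 ≤ ∫ w in ball z 1, ‖f.1 w‖ ^ 2 ∂(lebesgue n) := by
    calc V * ‖f.1 z‖ ^ 2 = ‖∫ w in ball z 1, f.1 w ^ 2 ∂(lebesgue n)‖ := by
          rw [h1, norm_mul, norm_pow, Complex.norm_real, Real.norm_of_nonneg hVpos.le]
      _ ≤ ∫ w in ball z 1, ‖f.1 w ^ 2‖ ∂(lebesgue n) := norm_integral_le_integral_norm _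
      _ = _ := by simp_rw [norm_pow]
  have hint : Integrable (fun w => ‖f.1 w‖ ^ 2 * Real.exp (-‖w‖ / σ)) (lebesgue n) := by
    have h := (f.2.2.integrable_norm_pow (by norm_num))
    simp only at h
    rw [measure, integrable_withDensity_iff_integrable_smul' (by fun_prop) (by simp)] at h
    refine (h.const_mul N⁻¹).congr (Eventually.of_forall fun w => ?_)
    simp only [smul_eq_mul]
    rw [ENNReal.toReal_ofReal (density_pos hσ w).le, ← hN]
    field_simp
  have h3 : m * ∫ w in ball z 1, ‖f.1 w‖ ^ 2 ∂(lebesgue n)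
      ≤ ∫ w, ‖f.1 w‖ ^ 2 * Real.exp (-‖w‖ / σ) ∂(lebesgue n) := by
    rw [← integral_const_mul]
    refine le_trans ?_ (setIntegral_le_integral hint
      (Eventually.of_forall fun w => by simp only [Pi.zero_apply]; positivity) (s := ball z 1))
    refine setIntegral_mono_on ?_ hint.integrableOn measurableSet_ball fun w hw => ?_
    · exact ((by fun_prop : Continuous fun w => m * ‖f.1 w‖ ^ 2).continuousOn.integrableOn_compact
        (isCompact_closedBall z 1)).mono_set ball_subset_closedBall
    · rw [mul_comm]
      refine mul_le_mul_of_nonneg_left (Real.exp_le_exp.2 ?_) (by positivity)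
      have : ‖w‖ ≤ R + 1 := by
        have := norm_le_norm_add_norm_sub' w z
        rw [mem_ball, dist_eq_norm] at hw
        linarith
      gcongr
  have h4 : N * (m * (V * ‖f.1 z‖ ^ 2)) ≤ ‖f‖ ^ 2 := by
    rw [norm_sq_eq]
    gcongr
    exact (mul_le_mul_of_nonneg_left h2 hmpos.le).trans h3
  refine le_of_sq_le_sq ?_ (by positivity)
  rw [mul_pow, Real.sq_sqrt (by positivity)]
  calc ‖f.1 z‖ ^ 2 = V⁻¹ * m⁻¹ * N⁻¹ * (N * (m * (V * ‖f.1 z‖ ^ 2))) := by field_simp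
    _ ≤ _ := by gcongr

/-- Cauchy's estimate for the derivative, uniformly on bounded sets. -/
theorem exists_fderiv_bound (R : ℝ) :
    ∃ C : ℝ, 0 ≤ C ∧
      ∀ f : Space n hσ, ∀ z : Cn n, ‖z‖ ≤ R → ‖fderiv ℂ f.1 z‖ ≤ C * ‖f‖ := by
  obtain ⟨C, hC, h⟩ := exists_eval_bound (n := n) hσ (R + 1)
  refine ⟨C, hC, fun f z hz => ContinuousLinearMap.opNorm_le_bound _ (by positivity) fun v => ?_⟩
  rcases eq_or_ne v 0 with rfl | hv
  · simp
  have hv' : 0 < ‖v‖ := norm_pos_iff.2 hv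
  have hd := f.2.1
  have hg : Differentiable ℂ (fun c : ℂ => f.1 (z + c • v)) := by fun_prop
  have h1 : deriv (fun c : ℂ => f.1 (z + c • v)) 0 = fderiv ℂ f.1 z v := by
    have hl : HasDerivAt (fun c : ℂ => z + c • v) v 0 := by
      simpa using ((hasDerivAt_id (0 : ℂ)).smul_const v).const_add z
    have hf : HasFDerivAt f.1 (fderiv ℂ f.1 z) (z + (0 : ℂ) • v) := by
      simpa using (hd z).hasFDerivAt
    exact (hf.comp_hasDerivAt (0 : ℂ) hl).deriv
  have h2 := Complex.norm_deriv_le_of_forall_mem_sphere_norm_le (c := 0) (R := ‖v‖⁻¹)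
    (C := C * ‖f‖) (inv_pos.2 hv') hg.diffContOnCl (fun c hc => by
      refine h f _ ?_
      rw [mem_sphere_zero_iff_norm] at hc
      calc ‖z + c • v‖ ≤ ‖z‖ + ‖c‖ * ‖v‖ := by rw [← norm_smul]; exact norm_add_le _ _
        _ = ‖z‖ + 1 := by rw [hc, inv_mul_cancel₀ hv'.ne']
        _ ≤ R + 1 := by gcongr)
  rw [h1] at h2
  simpa [div_inv_eq_mul] using h2

instance : CompleteSpace (Space n hσ) := by
  refine Metric.complete_of_cauchySeq_tendsto fun u hu => ?_
  have hudist := Metric.cauchySeq_iff.1 hu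
  -- the limit in `L²`
  have hiso : Isometry (toLpₗ (n := n) hσ) :=
    AddMonoidHomClass.isometry_of_norm _ fun _ => rfl
  obtain ⟨g, hg⟩ := cauchySeq_tendsto_of_complete (hiso.uniformContinuous.comp_cauchySeq hu)
  -- values and derivatives are uniformly Cauchy on bounded sets
  have hval : ∀ z : Cn n, CauchySeq fun k => (u k).1 z := by
    intro z
    obtain ⟨C, hC, h⟩ := exists_eval_bound (n := n) hσ ‖z‖
    rw [Metric.cauchySeq_iff]
    intro ε hε
    obtain ⟨K, hK⟩ := hudist (ε / (C + 1)) (by positivity)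
    refine ⟨K, fun a ha b hb => ?_⟩
    have h1 := h (u a - u b) z le_rfl
    have h2 := hK a ha b hb
    rw [dist_eq_norm] at h2 ⊢
    rw [lt_div_iff₀ (by positivity)] at h2
    calc ‖(u a).1 z - (u b).1 z‖ ≤ C * ‖u a - u b‖ := h1
      _ ≤ ‖u a - u b‖ * (C + 1) := by nlinarith [norm_nonneg (u a - u b)]
      _ < ε := h2
  have hder : ∀ R : ℝ, UniformCauchySeqOn (fun k => fderiv ℂ (u k).1) atTop (ball 0 R) := by
    intro R
    obtain ⟨C, hC, h⟩ := exists_fderiv_bound (n := n) hσ R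
    rw [Metric.uniformCauchySeqOn_iff]
    intro ε hε
    obtain ⟨K, hK⟩ := hudist (ε / (C + 1)) (by positivity)
    refine ⟨K, fun a ha b hb z hz => ?_⟩
    have h1 := h (u a - u b) z (by simpa using (mem_ball_zero_iff.1 hz).le)
    have h2 := hK a ha b hb
    have h3 : fderiv ℂ (u a - u b).1 z = fderiv ℂ (u a).1 z - fderiv ℂ (u b).1 z :=
      fderiv_sub ((u a).2.1 z) ((u b).2.1 z)
    rw [h3] at h1
    rw [dist_eq_norm] at h2 ⊢
    rw [lt_div_iff₀ (by positivity)] at h2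
    calc _ ≤ C * ‖u a - u b‖ := h1
      _ ≤ ‖u a - u b‖ * (C + 1) := by nlinarith [norm_nonneg (u a - u b)]
      _ < ε := h2
  choose F hF using fun z => cauchySeq_tendsto_of_complete (hval z)
  have hderz : ∀ z : Cn n, ∃ L, Tendsto (fun k => fderiv ℂ (u k).1 z) atTop (𝓝 L) := fun z =>
    cauchySeq_tendsto_of_complete
      ((hder (‖z‖ + 1)).cauchySeq (mem_ball_zero_iff.2 (lt_add_one ‖z‖)))
  choose F' hF' using hderz
  have hFd : Differentiable ℂ F := fun z =>
    (hasFDerivAt_of_tendstoUniformlyOn (s := ball (0 : Cn n) (‖z‖ + 1)) isOpen_ball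
      ((hder (‖z‖ + 1)).tendstoUniformlyOn_of_tendsto fun w _ => hF' w)
      (fun k w _ => ((u k).2.1 w).hasFDerivAt) (fun w _ => hF w)
      (mem_ball_zero_iff.2 (lt_add_one ‖z‖))).differentiableAt
  have hgF : g =ᵐ[measure n σ] F := by
    have h1 : TendstoInMeasure (measure n σ) (fun k => ⇑(toLpₗ hσ (u k))) atTop g :=
      tendstoInMeasure_of_tendsto_Lp hg
    obtain ⟨ns, hns, hae⟩ := h1.exists_seq_tendsto_ae
    have h2 : ∀ᵐ z ∂(measure n σ), ∀ k, toLpₗ hσ (u k) z = (u k).1 z :=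
      ae_all_iff.2 fun k => (u k).2.2.coeFn_toLp
    filter_upwards [hae, h2] with z hz hz2
    refine tendsto_nhds_unique hz ?_
    simp_rw [hz2]
    exact (hF z).comp hns.tendsto_atTop
  have hFL : MemLp F 2 (measure n σ) := (memLp_congr_ae hgF).1 (Lp.memLp g)
  refine ⟨Space.of hσ F hFd hFL, hiso.isEmbedding.tendsto_nhds_iff.2 ?_⟩
  have : toLpₗ hσ (Space.of hσ F hFd hFL) = g := by
    refine Lp.ext ?_
    exact (hFL.coeFn_toLp).trans hgF.symm
  rw [this]
  exact hg

/-- `H_{σ,1,ℂⁿ}` is a reproducing kernel Hilbert space of functions on `ℂⁿ`. -/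
noncomputable instance : RKHS ℂ (Space n hσ) (Cn n) ℂ where
  coeCLM :=
    { toFun := fun f => f.1
      map_add' := fun _ _ => rfl
      map_smul' := fun _ _ => rfl
      cont := by
        refine continuous_pi fun z => ?_
        obtain ⟨C, hC, h⟩ := exists_eval_bound (n := n) hσ ‖z‖
        let l : Space n hσ →ₗ[ℂ] ℂ :=
          { toFun := fun f => f.1 z, map_add' := fun _ _ => rfl, map_smul' := fun _ _ => rfl }
        exact (l.mkContinuous C fun f => h f z le_rfl).continuous }
  coeCLM_injective := fun _ _ h => Subtype.ext h

theorem Space.differentiable (f : Space n hσ) : Differentiable ℂ f := f.2.1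

theorem Space.memLp (f : Space n hσ) : MemLp f 2 (measure n σ) := f.2.2

theorem Space.coe_of (f : Cn n → ℂ) (hf : Differentiable ℂ f) (hf' : MemLp f 2 (measure n σ)) :
    ⇑(Space.of hσ f hf hf') = f := rfl

theorem Space.norm_sq_eq (f : Space n hσ) :
    ‖f‖ ^ 2 = ((2 * Real.pi * σ ^ 2) ^ n)⁻¹ *
      ∫ z, ‖f z‖ ^ 2 * Real.exp (-‖z‖ / σ) ∂(lebesgue n) :=
  Laplace.norm_sq_eq hσ f

/-- The reproducing kernel function `K_z`, characterised by `⟪K_z, f⟫ = f z`. -/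
noncomputable def kernelFun (z : Cn n) : Space n hσ := RKHS.kerFun (Space n hσ) z 1

theorem inner_kernelFun (z : Cn n) (f : Space n hσ) : inner ℂ (kernelFun hσ z) f = f z := by
  simp [kernelFun, RKHS.kerFun_inner]

/-- The Koopman operator `f ↦ f ∘ φ`, with domain `{f ∈ H : f ∘ φ ∈ H}`. -/
noncomputable def koopman (φ : Cn n → Cn n) : Space n hσ →ₗ.[ℂ] Space n hσ where
  domain :=
    { carrier := {f | (⇑f ∘ φ) ∈ holomorphicL2 n σ}
      add_mem' := fun hf hg => (holomorphicL2 n σ).add_mem hf hg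
      zero_mem' := (holomorphicL2 n σ).zero_mem
      smul_mem' := fun c _ hf => (holomorphicL2 n σ).smul_mem c hf }
  toFun :=
    { toFun := fun f => Space.of hσ (⇑f.1 ∘ φ) f.2.1 f.2.2
      map_add' := fun _ _ => rfl
      map_smul' := fun _ _ => rfl }

/-- `K_φ` is bounded over `H`: it is defined on all of `H` and bounded there. -/
def KoopmanBounded (φ : Cn n → Cn n) : Prop :=
  (koopman hσ φ).domain = ⊤ ∧
    ∃ C : ℝ, ∀ f : (koopman hσ φ).domain, ‖koopman hσ φ f‖ ≤ C * ‖f‖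

variable {hσ}

/-- A bounded Koopman operator as a continuous linear operator on `H`. -/
noncomputable def KoopmanBounded.toCLM {φ : Cn n → Cn n} (h : KoopmanBounded hσ φ) :
    Space n hσ →L[ℂ] Space n hσ :=
  LinearMap.mkContinuousOfExistsBound
    ((koopman hσ φ).toFun ∘ₗ LinearMap.codRestrict (koopman hσ φ).domain LinearMap.id
      fun _ => h.1 ▸ Submodule.mem_top)
    (h.2.imp fun _ hC f => hC ⟨f, h.1 ▸ Submodule.mem_top⟩)

theorem KoopmanBounded.toCLM_apply {φ : Cn n → Cn n} (h : KoopmanBounded hσ φ)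
    (f : Space n hσ) (z : Cn n) : h.toCLM f z = f (φ z) := rfl

/-- `Π_z(φ;σ) = ‖K_φ* K_z‖² / ‖K_z‖²`. -/
noncomputable def KoopmanBounded.ratio {φ : Cn n → Cn n} (h : KoopmanBounded hσ φ)
    (z : Cn n) : ℝ :=
  ‖ContinuousLinearMap.adjoint h.toCLM (kernelFun hσ z)‖ ^ 2 / ‖kernelFun hσ z‖ ^ 2

end Space

end Laplace

/-!
Write `T = 𝓚_φ`, where `φ z = A z + B`, and let `K_z` be the kernel function at `z`. Since
`T* K_z = K_{φ z}` (`adjoint_koopman_kernelFun`), the ratio is `‖K_{φ z}‖² / ‖K_z‖²`. Only soft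
information about the kernel is needed, and no asymptotic expansion of `K(z, z)`. The weight depends
on `‖z‖` alone, so the kernel is invariant under the unitary group. Together with the maximum
principle this makes `‖K_z‖` a nondecreasing function of `‖z‖` (`norm_kernelFun_mono`), and together
with the identity theorem it gives `K_w(c z) = K_{c̄ w}(z)` for all complex `c`
(`kernelFun_apply_smul`). Finally `‖K_z‖` lies between constant multiples of `exp (‖z‖ / (4σ))`
(`exists_le_norm_kernelFun`, by an exponential test function) and of `exp (‖z‖ / (2σ))`
(`exists_norm_kernelFun_le`, since translations are bounded on `H`).

*Compactness implies that the ratio tends to zero.* By the scaling identity a fixed kernel function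
`K_w` is of exponential type zero, hence `K_w(φ z) / ‖K_z‖ → 0`. So the functions
`T T* (K_z / ‖K_z‖)` tend to zero pointwise; as `T T*` is compact they tend to zero in norm, and
their norms bound the ratio (`tendsto_ratio_of_isCompactOperator`).

*The converse.* If `‖A v‖ ≥ ‖v‖` for some `v ≠ 0`, then `‖φ z‖ ≥ ‖z‖` along a ray, and by monotonicity
the ratio is at least `1` there (`norm_lt_of_tendsto_ratio`). So a ratio tending to zero forces the
operator norm of `A` to be some `a < 1`. Then `‖f (φ z)‖² exp (-‖z‖ / σ)` is at most a constant times
`exp (-(1 - a) ‖z‖ / σ)` for `f` in the unit ball, and dominated convergence shows that `T` is small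
on the functions vanishing on a large finite subset of a dense sequence. These functions form the
orthogonal complement of a finite-dimensional space, so `T` is a norm limit of operators of finite
rank (`isCompactOperator_of_norm_le`).
-/

/-! ### The weighted measure and unitary maps -/

namespace Laplace

section Measure

variable {n : ℕ}

theorem integrable_exp_neg_mul_norm {c : ℝ} (hc : 0 < c) :
    Integrable (fun z : Cn n => Real.exp (-(c * ‖z‖))) (lebesgue n) := by
  set m := Module.finrank ℝ (Cn n) + 1 with hm
  have h := integrable_one_add_norm (E := Cn n) (μ := lebesgue n) (r := m) (by simp [hm])
  refine (h.const_mul (Real.exp c * m.factorial / c ^ m)).mono' (by fun_prop)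
    (Eventually.of_forall fun z => ?_)
  rw [Real.norm_of_nonneg (Real.exp_pos _).le, Real.rpow_neg (by positivity), Real.rpow_natCast]
  -- the Taylor bound `x ^ m / m! ≤ exp x` at `x = c * (1 + ‖z‖)`
  have h1 := Real.pow_div_factorial_le_exp (c * (1 + ‖z‖)) (by positivity) m
  rw [mul_add, mul_one, Real.exp_add] at h1
  rw [Real.exp_neg, ← div_eq_mul_inv, div_div, inv_eq_one_div,
    div_le_div_iff₀ (Real.exp_pos _) (by positivity)]
  rw [div_le_iff₀ (by positivity), ← mul_one_add, mul_pow] at h1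
  linarith

theorem integrable_measure_iff {σ : ℝ} (hσ : 0 < σ) {g : Cn n → ℝ} :
    Integrable g (measure n σ) ↔
      Integrable (fun z => g z * Real.exp (-‖z‖ / σ)) (lebesgue n) := by
  rw [measure, integrable_withDensity_iff_integrable_smul' (by fun_prop) (by simp)]
  have hN : (((2 * Real.pi * σ ^ 2) ^ n)⁻¹ : ℝ) ≠ 0 := by positivity
  rw [← integrable_const_mul_iff (IsUnit.mk0 _ hN) (fun z => g z * Real.exp (-‖z‖ / σ))]
  refine integrable_congr (Eventually.of_forall fun z => ?_)
  simp only [smul_eq_mul]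
  rw [ENNReal.toReal_ofReal (density_pos hσ z).le]
  ring

theorem integrable_exp_mul_norm {σ : ℝ} (hσ : 0 < σ) {a : ℝ} (ha : a < σ⁻¹) :
    Integrable (fun z : Cn n => Real.exp (a * ‖z‖)) (measure n σ) := by
  rw [integrable_measure_iff hσ]
  refine (integrable_exp_neg_mul_norm (sub_pos.2 ha)).congr (Eventually.of_forall fun z => ?_)
  simp only
  rw [← Real.exp_add]
  congr 1
  ring

/-- Entire functions of exponential type less than `1 / (2σ)` belong to `H`. -/
theorem memLp_of_le_exp {σ : ℝ} (hσ : 0 < σ) {f : Cn n → ℂ} (hf : Continuous f) {a C : ℝ}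
    (ha : 2 * a < σ⁻¹) (h : ∀ z, ‖f z‖ ≤ C * Real.exp (a * ‖z‖)) : MemLp f 2 (measure n σ) := by
  rw [memLp_two_iff_integrable_sq_norm hf.aestronglyMeasurable]
  refine ((integrable_exp_mul_norm hσ ha).const_mul (C ^ 2)).mono'
    (by fun_prop) (Eventually.of_forall fun z => ?_)
  rw [Real.norm_of_nonneg (by positivity)]
  calc ‖f z‖ ^ 2 ≤ (C * Real.exp (a * ‖z‖)) ^ 2 := by gcongr; exact h z
    _ = _ := by rw [mul_pow, ← Real.exp_nat_mul]; congr 2; push_cast; ring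

theorem measurePreserving_lebesgue (U : Cn n ≃ₗᵢ[ℂ] Cn n) :
    MeasurePreserving U (lebesgue n) (lebesgue n) := by
  refine ⟨U.continuous.measurable, ?_⟩
  have : ((lebesgue n).map U).IsAddHaarMeasure :=
    U.toContinuousLinearEquiv.isAddHaarMeasure_map (lebesgue n)
  have h := Measure.isAddLeftInvariant_eq_smul ((lebesgue n).map U) (lebesgue n)
  -- the scalar relating the two Haar measures is read off on the unit ball
  have h1 : (lebesgue n).map U (ball 0 1) = lebesgue n (ball 0 1) := by
    rw [Measure.map_apply U.continuous.measurable measurableSet_ball]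
    congr 1
    ext w
    simp
  rw [h] at h1 ⊢
  have h2 : lebesgue n (ball (0 : Cn n) 1) ≠ 0 := (measure_ball_pos _ 0 one_pos).ne'
  have h3 : lebesgue n (ball (0 : Cn n) 1) ≠ ⊤ := measure_ball_lt_top.ne
  set k := Measure.addHaarScalarFactor ((lebesgue n).map U) (lebesgue n)
  have h4 : (k : ENNReal) = 1 := by
    rw [Measure.smul_apply, ENNReal.smul_def, smul_eq_mul] at h1
    exact (ENNReal.mul_eq_right h2 h3).1 h1
  have : k = 1 := by exact_mod_cast h4
  rw [this, one_smul]

/-- The weight of `H` depends on `‖z‖` only, so it is invariant under unitary maps. -/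
theorem measurePreserving_measure (σ : ℝ) (U : Cn n ≃ₗᵢ[ℂ] Cn n) :
    MeasurePreserving U (measure n σ) (measure n σ) := by
  have hU := measurePreserving_lebesgue U
  have he : MeasurableEmbedding U := U.toHomeomorph.measurableEmbedding
  refine ⟨hU.measurable, ?_⟩
  ext s hs
  rw [Measure.map_apply hU.measurable hs, measure, withDensity_apply _ hs,
    withDensity_apply _ (hU.measurable hs), ← hU.setLIntegral_comp_preimage_emb he _ s]
  simp

end Measure

/-- The unitary group acts transitively on spheres. -/
theorem exists_linearIsometryEquiv_apply_eq {n : ℕ} {v w : Cn n} (h : ‖v‖ = ‖w‖) :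
    ∃ U : Cn n ≃ₗᵢ[ℂ] Cn n, U v = w := by
  rcases eq_or_ne v 0 with rfl | hv
  · exact ⟨.refl ℂ _, by simpa using (norm_eq_zero.1 (h.symm.trans norm_zero)).symm⟩
  let L : Submodule.span ℂ {v} →ₗ[ℂ] Cn n :=
    LinearMap.toSpanSingleton ℂ (Cn n) w ∘ₗ (LinearEquiv.toSpanNonzeroSingleton ℂ _ v hv).symm
  have hL : ∀ c : ℂ, L (c • ⟨v, Submodule.mem_span_singleton_self v⟩) = c • w := fun c => by
    rw [map_smul]
    congr 1
    simp only [L, LinearMap.comp_apply, LinearEquiv.coe_coe]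
    have : (LinearEquiv.toSpanNonzeroSingleton ℂ _ v hv).symm
        ⟨v, Submodule.mem_span_singleton_self v⟩ = 1 := by
      rw [LinearEquiv.symm_apply_eq, LinearEquiv.toSpanNonzeroSingleton_one]
    rw [this]; simp
  let I : Submodule.span ℂ {v} →ₗᵢ[ℂ] Cn n := ⟨L, fun x => by
    obtain ⟨x, hx⟩ := x
    obtain ⟨c, rfl⟩ := Submodule.mem_span_singleton.1 hx
    have := hL c
    rw [show (⟨c • v, hx⟩ : Submodule.span ℂ {v}) =
      c • ⟨v, Submodule.mem_span_singleton_self v⟩ from rfl, this]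
    simp [norm_smul, h]⟩
  refine ⟨I.extend.toLinearIsometryEquiv rfl, ?_⟩
  have h1 := I.extend_apply ⟨v, Submodule.mem_span_singleton_self v⟩
  have h2 := hL 1
  rw [one_smul, one_smul] at h2
  exact h1.trans h2

end Laplace

/-! ### Symmetry and monotonicity of the kernel -/

namespace Laplace

section Kernel

variable {n : ℕ} {σ : ℝ} {hσ : 0 < σ}

theorem norm_apply_le (f : Space n hσ) (z : Cn n) : ‖f z‖ ≤ ‖kernelFun hσ z‖ * ‖f‖ := by
  rw [← inner_kernelFun]
  exact norm_inner_le_norm _ _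

theorem kernelFun_apply (w z : Cn n) :
    kernelFun hσ w z = inner ℂ (kernelFun hσ z) (kernelFun hσ w) :=
  (inner_kernelFun hσ z _).symm

theorem kernelFun_apply_symm (w z : Cn n) :
    kernelFun hσ w z = (starRingEnd ℂ) (kernelFun hσ z w) := by
  rw [kernelFun_apply, kernelFun_apply, inner_conj_symm]

theorem eq_of_inner_eq_apply {g : Space n hσ} {z : Cn n}
    (h : ∀ f : Space n hσ, inner ℂ g f = f z) : g = kernelFun hσ z :=
  ext_inner_right ℂ fun f => by rw [h, inner_kernelFun]

theorem norm_kernelFun_pos (z : Cn n) : 0 < ‖kernelFun hσ z‖ := by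
  rw [norm_pos_iff]
  intro h
  have h1 := inner_kernelFun hσ z (Space.of hσ (fun _ => 1) (differentiable_const 1)
    (memLp_of_le_exp hσ continuous_const (a := 0) (C := 1) (by simpa using hσ) (by simp)))
  rw [h, inner_zero_left, Space.coe_of] at h1
  exact zero_ne_one h1

/-- Composition with a unitary map, as a map of `H` to itself. -/
noncomputable def compUnitary (U : Cn n ≃ₗᵢ[ℂ] Cn n) (f : Space n hσ) : Space n hσ :=
  Space.of hσ (f ∘ U) (f.differentiable.comp U.toContinuousLinearEquiv.differentiable)
    (f.memLp.comp_measurePreserving (measurePreserving_measure σ U))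

theorem compUnitary_apply (U : Cn n ≃ₗᵢ[ℂ] Cn n) (f : Space n hσ) (z : Cn n) :
    compUnitary U f z = f (U z) := rfl

theorem inner_compUnitary (U : Cn n ≃ₗᵢ[ℂ] Cn n) (f g : Space n hσ) :
    inner ℂ (compUnitary U f) (compUnitary U g) = inner ℂ f g := by
  rw [inner_def, inner_def]
  exact (measurePreserving_measure σ U).integral_comp U.toHomeomorph.measurableEmbedding
    (fun z => g z * (starRingEnd ℂ) (f z))

theorem compUnitary_kernelFun (U : Cn n ≃ₗᵢ[ℂ] Cn n) (z : Cn n) :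
    compUnitary U (kernelFun hσ (U z)) = kernelFun hσ z := by
  refine eq_of_inner_eq_apply fun f => ?_
  have h : compUnitary U (compUnitary U.symm f) = f := by
    ext w
    simp [compUnitary_apply]
  rw [← h, inner_compUnitary, inner_kernelFun, h, compUnitary_apply, U.symm_apply_apply]

theorem kernelFun_unitary_apply (U : Cn n ≃ₗᵢ[ℂ] Cn n) (w z : Cn n) :
    kernelFun hσ (U w) (U z) = kernelFun hσ w z := by
  rw [← compUnitary_apply, compUnitary_kernelFun]

theorem norm_kernelFun_unitary (U : Cn n ≃ₗᵢ[ℂ] Cn n) (z : Cn n) :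
    ‖kernelFun hσ (U z)‖ = ‖kernelFun hσ z‖ := by
  have h := kernelFun_unitary_apply (hσ := hσ) U z z
  rw [kernelFun_apply, kernelFun_apply, inner_self_eq_norm_sq_to_K, inner_self_eq_norm_sq_to_K] at h
  have h' : ‖kernelFun hσ (U z)‖ ^ 2 = ‖kernelFun hσ z‖ ^ 2 := by exact_mod_cast h
  exact (sq_eq_sq₀ (norm_nonneg _) (norm_nonneg _)).1 h'

theorem norm_kernelFun_eq_of_norm_eq {w z : Cn n} (h : ‖w‖ = ‖z‖) :
    ‖kernelFun hσ w‖ = ‖kernelFun hσ z‖ := by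
  obtain ⟨U, rfl⟩ := exists_linearIsometryEquiv_apply_eq h
  exact (norm_kernelFun_unitary U w).symm

/-- `K(z, z)` is a nondecreasing function of `‖z‖`: by the maximum principle on the disc
`{c • z : ‖c‖ ≤ 1}`, the kernel function at `s • z` is bounded by the norms of the kernel functions
on the unit circle, which all agree with that at `z`. -/
theorem norm_kernelFun_mono {w z : Cn n} (h : ‖w‖ ≤ ‖z‖) :
    ‖kernelFun hσ w‖ ≤ ‖kernelFun hσ z‖ := by
  rcases eq_or_ne z 0 with rfl | hz
  · have : w = 0 := by simpa using h
    rw [this]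
  have hz' : 0 < ‖z‖ := norm_pos_iff.2 hz
  set s : ℂ := ((‖w‖ / ‖z‖ : ℝ) : ℂ) with hs
  have hsn : ‖s‖ = ‖w‖ / ‖z‖ := by
    rw [hs, Complex.norm_real, Real.norm_of_nonneg (by positivity)]
  have hws : ‖w‖ = ‖s • z‖ := by
    rw [norm_smul, hsn, div_mul_cancel₀ _ hz'.ne']
  rw [norm_kernelFun_eq_of_norm_eq hws]
  set K := kernelFun hσ (s • z) with hK
  have hKpos : 0 < ‖K‖ := norm_kernelFun_pos _
  have hd : Differentiable ℂ (fun c : ℂ => K (c • z)) :=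
    K.differentiable.comp (by fun_prop)
  have hmax := Complex.norm_le_of_forall_mem_frontier_norm_le (U := ball (0 : ℂ) 1)
    (f := fun c : ℂ => K (c • z)) (C := ‖kernelFun hσ z‖ * ‖K‖) isBounded_ball hd.diffContOnCl
    (fun c hc => by
      rw [frontier_ball _ one_ne_zero, mem_sphere_zero_iff_norm] at hc
      refine (norm_apply_le K (c • z)).trans_eq ?_
      rw [norm_kernelFun_eq_of_norm_eq (w := c • z) (z := z) (by rw [norm_smul, hc, one_mul])])
    (z := s) (by
      rw [closure_ball _ one_ne_zero, mem_closedBall_zero_iff, hsn]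
      exact div_le_one_of_le₀ h hz'.le)
  rw [hK, kernelFun_apply, inner_self_eq_norm_sq_to_K, ← hK] at hmax
  simp only [norm_pow, Complex.coe_algebraMap, Complex.norm_real, norm_norm] at hmax
  rw [sq] at hmax
  exact le_of_mul_le_mul_right hmax hKpos

/-- Both sides are entire functions of `c`. On the unit circle they agree, since the kernel is invariant
under the simultaneous rotation of both arguments by `c`. -/
theorem kernelFun_apply_smul (w z : Cn n) (c : ℂ) :
    kernelFun hσ w (c • z) = kernelFun hσ ((starRingEnd ℂ) c • w) z := by
  have h1 : Differentiable ℂ (fun c : ℂ => kernelFun hσ w (c • z)) :=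
    (kernelFun hσ w).differentiable.comp (by fun_prop)
  have h2 : Differentiable ℂ (fun c : ℂ => kernelFun hσ ((starRingEnd ℂ) c • w) z) := by
    have h3 : Differentiable ℂ (fun c : ℂ => kernelFun hσ z (c • w)) :=
      (kernelFun hσ z).differentiable.comp (by fun_prop)
    have h4 : (fun c : ℂ => kernelFun hσ ((starRingEnd ℂ) c • w) z) =
        (starRingEnd ℂ) ∘ (fun c : ℂ => kernelFun hσ z (c • w)) ∘ (starRingEnd ℂ) := by
      ext c
      exact kernelFun_apply_symm _ _
    rw [h4]
    exact fun c => by simpa using (h3 ((starRingEnd ℂ) c)).conj_conj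
  have hcirc : ∀ c : ℂ, ‖c‖ = 1 →
      kernelFun hσ w (c • z) = kernelFun hσ ((starRingEnd ℂ) c • w) z := by
    intro c hc
    have hcc : c * (starRingEnd ℂ) c = 1 := by
      rw [Complex.mul_conj, Complex.normSq_eq_norm_sq, hc]; simp
    let U : Cn n ≃ₗᵢ[ℂ] Cn n :=
      ⟨LinearEquiv.smulOfUnit (Units.mk c ((starRingEnd ℂ) c) hcc (by rw [mul_comm, hcc])),
        fun x => by
          change ‖c • x‖ = ‖x‖
          rw [norm_smul, hc, one_mul]⟩
    have hU : ∀ x, U x = c • x := fun _ => rfl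
    rw [← kernelFun_unitary_apply U ((starRingEnd ℂ) c • w) z, hU, hU, smul_smul, hcc, one_smul]
  -- the unit circle accumulates at `1`
  have hfreq : ∃ᶠ c in 𝓝[≠] (1 : ℂ),
      kernelFun hσ w (c • z) = kernelFun hσ ((starRingEnd ℂ) c • w) z := by
    have ht : Tendsto (fun t : ℝ => Complex.exp (t * Complex.I)) (𝓝[>] 0) (𝓝[≠] 1) := by
      refine tendsto_nhdsWithin_iff.2 ⟨?_, ?_⟩
      · have : Continuous (fun t : ℝ => Complex.exp (t * Complex.I)) := by fun_prop
        simpa using (this.tendsto 0).mono_left nhdsWithin_le_nhds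
      · filter_upwards [Ioo_mem_nhdsGT Real.pi_pos] with t ht h
        have := congrArg Complex.im (Set.mem_singleton_iff.1 h)
        rw [Complex.exp_ofReal_mul_I_im, Complex.one_im] at this
        exact (Real.sin_pos_of_pos_of_lt_pi ht.1 ht.2).ne' this
    exact ht.frequently (Eventually.of_forall fun t => hcirc _ (by simp)).frequently
  exact congrFun (AnalyticOnNhd.eq_of_frequently_eq (fun c _ => h1.analyticAt c)
    (fun c _ => h2.analyticAt c) hfreq) c

end Kernel

end Laplace

/-! ### Growth of the kernel -/

namespace Laplace

section Growth

variable {n : ℕ} {σ : ℝ} {hσ : 0 < σ}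

theorem integrable_norm_sq_mul_exp (f : Space n hσ) :
    Integrable (fun z => ‖f z‖ ^ 2 * Real.exp (-‖z‖ / σ)) (lebesgue n) :=
  (integrable_measure_iff hσ).1 (f.memLp.integrable_norm_pow (by norm_num))

/-- Translation by `b` is bounded on `H`, because `‖z - b‖ ≥ ‖z‖ - ‖b‖` in the weight. -/
theorem exists_translate (f : Space n hσ) (b : Cn n) :
    ∃ g : Space n hσ, (∀ z, g z = f (z + b)) ∧ ‖g‖ ≤ Real.exp (‖b‖ / (2 * σ)) * ‖f‖ := by
  set N := ((2 * Real.pi * σ ^ 2) ^ n)⁻¹ with hN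
  have hNpos : 0 < N := by positivity
  have hc : Continuous f := f.differentiable.continuous
  have hle : ∀ z : Cn n, ‖f (z + b)‖ ^ 2 * Real.exp (-‖z‖ / σ) ≤
      Real.exp (‖b‖ / σ) * (‖f (z + b)‖ ^ 2 * Real.exp (-‖z + b‖ / σ)) := by
    intro z
    rw [mul_left_comm, ← Real.exp_add, ← add_div]
    gcongr
    linarith [norm_add_le z b]
  have hi := (integrable_norm_sq_mul_exp f).comp_add_right b
  have hi' : Integrable (fun z => ‖f (z + b)‖ ^ 2 * Real.exp (-‖z‖ / σ)) (lebesgue n) := by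
    refine (hi.const_mul (Real.exp (‖b‖ / σ))).mono' (by fun_prop)
      (Eventually.of_forall fun z => ?_)
    rw [Real.norm_of_nonneg (by positivity)]
    exact hle z
  have hmem : MemLp (fun z => f (z + b)) 2 (measure n σ) := by
    rw [memLp_two_iff_integrable_sq_norm (by fun_prop), integrable_measure_iff hσ]
    exact hi'
  refine ⟨Space.of hσ (fun z => f (z + b)) (f.differentiable.comp (by fun_prop)) hmem,
    fun _ => rfl, ?_⟩
  refine le_of_sq_le_sq ?_ (by positivity)
  rw [mul_pow (Real.exp _), Space.norm_sq_eq, Space.norm_sq_eq, ← Real.exp_nat_mul, ← hN,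
    Space.coe_of]
  have h2 : ((2 : ℕ) : ℝ) * (‖b‖ / (2 * σ)) = ‖b‖ / σ := by push_cast; field_simp
  rw [h2, mul_left_comm]
  refine mul_le_mul_of_nonneg_left ?_ hNpos.le
  rw [← integral_add_right_eq_self
    (fun z => ‖f z‖ ^ 2 * Real.exp (-‖z‖ / σ)) b, ← integral_const_mul]
  exact integral_mono hi' (hi.const_mul _) hle

/-- The translate of `K_z` by `z` has the value `‖K_z‖²` at the origin, where evaluation is bounded. -/
theorem exists_norm_kernelFun_le (hσ : 0 < σ) (n : ℕ) :
    ∃ C : ℝ, 0 ≤ C ∧ ∀ z : Cn n, ‖kernelFun hσ z‖ ≤ C * Real.exp (‖z‖ / (2 * σ)) := by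
  obtain ⟨C, hC, h⟩ := exists_eval_bound (n := n) hσ 0
  refine ⟨C, hC, fun z => ?_⟩
  obtain ⟨g, hg, hgn⟩ := exists_translate (kernelFun hσ z) z
  have h0 : ‖g 0‖ ≤ C * ‖g‖ := h g 0 (by simp)
  rw [hg, zero_add, kernelFun_apply, inner_self_eq_norm_sq_to_K] at h0
  simp only [norm_pow, Complex.coe_algebraMap, Complex.norm_real, norm_norm] at h0
  refine le_of_mul_le_mul_right ?_ (norm_kernelFun_pos (hσ := hσ) z)
  calc ‖kernelFun hσ z‖ * ‖kernelFun hσ z‖ = ‖kernelFun hσ z‖ ^ 2 := (sq _).symm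
    _ ≤ C * ‖g‖ := h0
    _ ≤ C * (Real.exp (‖z‖ / (2 * σ)) * ‖kernelFun hσ z‖) := by gcongr
    _ = _ := by ring

/-- The function `w ↦ exp (⟪u, w⟫ / (4σ))`, where `u` is the unit vector in the direction of `z`
(and `u = 0` if `z = 0`), has norm bounded independently of `z` and takes the value `exp (‖z‖ / (4σ))` at `z`. -/
theorem exists_le_norm_kernelFun (hσ : 0 < σ) (n : ℕ) :
    ∃ c : ℝ, 0 < c ∧ ∀ z : Cn n, c * Real.exp (‖z‖ / (4 * σ)) ≤ ‖kernelFun hσ z‖ := by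
  set N := ((2 * Real.pi * σ ^ 2) ^ n)⁻¹ with hN
  have hNpos : 0 < N := by positivity
  set D := N * ∫ w : Cn n, Real.exp (-((2 * σ)⁻¹ * ‖w‖)) ∂(lebesgue n) with hD
  have hD0 : 0 ≤ D := by positivity
  refine ⟨(√D + 1)⁻¹, by positivity, fun z => ?_⟩
  set u : Cn n := ((‖z‖⁻¹ : ℝ) : ℂ) • z with hu
  have hun : ‖u‖ ≤ 1 := by
    rw [hu, norm_smul, Complex.norm_real, norm_inv, norm_norm]
    exact inv_mul_le_one
  have huz : inner ℂ u z = (‖z‖ : ℂ) := by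
    rw [hu, inner_smul_left, inner_self_eq_norm_sq_to_K, Complex.conj_ofReal]
    rcases eq_or_ne z 0 with rfl | hz
    · simp
    have : ((‖z‖ : ℝ) : ℂ) ≠ 0 := by simpa using hz
    push_cast
    field_simp
    simp
  set e : Cn n → ℂ := fun w => Complex.exp (inner ℂ u w / (4 * σ : ℝ)) with he
  have hin : Differentiable ℂ (fun w : Cn n => inner ℂ u w) := (innerSL ℂ u).differentiable
  have hed : Differentiable ℂ e := by
    simpa only [he, div_eq_mul_inv] using (hin.mul_const ((4 * σ : ℝ) : ℂ)⁻¹).cexp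
  have hen : ∀ w, ‖e w‖ ≤ Real.exp ((4 * σ)⁻¹ * ‖w‖) := by
    intro w
    rw [he, Complex.norm_exp, Complex.div_ofReal_re, div_eq_inv_mul]
    gcongr
    calc (inner ℂ u w).re ≤ ‖inner ℂ u w‖ := Complex.re_le_norm _
      _ ≤ ‖u‖ * ‖w‖ := norm_inner_le_norm _ _
      _ ≤ ‖w‖ := by nlinarith [norm_nonneg w]
  have hmem : MemLp e 2 (measure n σ) := by
    refine memLp_of_le_exp hσ hed.continuous (a := (4 * σ)⁻¹) (C := 1) ?_ (by simpa using hen)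
    have : (0:ℝ) < σ⁻¹ := by positivity
    rw [mul_inv]
    linarith
  set f := Space.of hσ e hed hmem with hf
  have hfn : ‖f‖ ≤ √D := by
    refine Real.le_sqrt_of_sq_le ?_
    rw [Space.norm_sq_eq, ← hN, hD]
    gcongr
    · exact integrable_norm_sq_mul_exp f
    · exact integrable_exp_neg_mul_norm (by positivity)
    intro w
    simp only [hf, Space.coe_of]
    calc ‖e w‖ ^ 2 * Real.exp (-‖w‖ / σ)
        ≤ Real.exp ((4 * σ)⁻¹ * ‖w‖) ^ 2 * Real.exp (-‖w‖ / σ) := by gcongr; exact hen w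
      _ = _ := by
        rw [← Real.exp_nat_mul, ← Real.exp_add]
        congr 1
        push_cast
        field_simp
        ring
  have hval : ‖f z‖ = Real.exp (‖z‖ / (4 * σ)) := by
    rw [hf, Space.coe_of, he]
    simp only
    rw [huz, ← Complex.ofReal_div, Complex.norm_exp_ofReal]
  rw [inv_mul_le_iff₀ (by positivity), ← hval]
  calc ‖f z‖ ≤ ‖kernelFun hσ z‖ * ‖f‖ := norm_apply_le f z
    _ ≤ ‖kernelFun hσ z‖ * (√D + 1) := by gcongr; linarith
    _ = _ := mul_comm _ _

/-- Kernel functions are of exponential type zero: `K_w(z) = K_{M w}(z / M)` for every `M > 0`. -/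
theorem exists_kernelFun_apply_le (w : Cn n) {a : ℝ} (ha : 0 < a) :
    ∃ C : ℝ, 0 ≤ C ∧ ∀ z : Cn n, ‖kernelFun hσ w z‖ ≤ C * Real.exp (a * ‖z‖) := by
  obtain ⟨C, hC, h⟩ := exists_norm_kernelFun_le hσ n
  -- for this `M` the bound `exp (‖z / M‖ / (2 * σ))` for `‖K_{z / M}‖` is `exp (a * ‖z‖)`
  set M : ℝ := (2 * σ * a)⁻¹ with hM
  have hMpos : 0 < M := by positivity
  have hM0 : (M : ℂ) ≠ 0 := by exact_mod_cast hMpos.ne'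
  refine ⟨C * ‖kernelFun hσ ((M : ℂ) • w)‖, by positivity, fun z => ?_⟩
  have hz : z = (M : ℂ) • ((M : ℂ)⁻¹ • z) := by rw [smul_smul, mul_inv_cancel₀ hM0, one_smul]
  have h1 : kernelFun hσ w z = kernelFun hσ ((M : ℂ) • w) ((M : ℂ)⁻¹ • z) := by
    conv_lhs => rw [hz]
    rw [kernelFun_apply_smul, Complex.conj_ofReal]
  have h2 : ‖(M : ℂ)⁻¹ • z‖ / (2 * σ) = a * ‖z‖ := by
    rw [norm_smul, norm_inv, Complex.norm_real, Real.norm_of_nonneg hMpos.le, hM]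
    field_simp
  calc ‖kernelFun hσ w z‖
      ≤ ‖kernelFun hσ ((M : ℂ)⁻¹ • z)‖ * ‖kernelFun hσ ((M : ℂ) • w)‖ := by
        rw [h1]; exact norm_apply_le _ _
    _ ≤ C * Real.exp (a * ‖z‖) * ‖kernelFun hσ ((M : ℂ) • w)‖ := by
        rw [← h2]; gcongr; exact h _
    _ = _ := by ring

end Growth

end Laplace

/-! ### The adjoint of the Koopman operator and the ratio -/

namespace Laplace

section Koopman

variable {n : ℕ} {σ : ℝ} {hσ : 0 < σ} {φ : Cn n → Cn n}

theorem adjoint_koopman_kernelFun (h : KoopmanBounded hσ φ) (z : Cn n) :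
    ContinuousLinearMap.adjoint h.toCLM (kernelFun hσ z) = kernelFun hσ (φ z) :=
  eq_of_inner_eq_apply fun f => by
    rw [ContinuousLinearMap.adjoint_inner_left, inner_kernelFun, h.toCLM_apply]

theorem ratio_eq (h : KoopmanBounded hσ φ) (z : Cn n) :
    h.ratio z = ‖kernelFun hσ (φ z)‖ ^ 2 / ‖kernelFun hσ z‖ ^ 2 := by
  rw [KoopmanBounded.ratio, adjoint_koopman_kernelFun]

/-- The unit vector `K_z / ‖K_z‖`. -/
noncomputable def normalizedKernel (hσ : 0 < σ) (z : Cn n) : Space n hσ :=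
  ((‖kernelFun hσ z‖⁻¹ : ℝ) : ℂ) • kernelFun hσ z

theorem norm_normalizedKernel (z : Cn n) : ‖normalizedKernel hσ z‖ = 1 := by
  rw [normalizedKernel, norm_smul, Complex.norm_real, norm_inv, norm_norm,
    inv_mul_cancel₀ (norm_kernelFun_pos z).ne']

theorem adjoint_koopman_normalizedKernel (h : KoopmanBounded hσ φ) (z : Cn n) :
    ContinuousLinearMap.adjoint h.toCLM (normalizedKernel hσ z) =
      ((‖kernelFun hσ z‖⁻¹ : ℝ) : ℂ) • kernelFun hσ (φ z) := by
  rw [normalizedKernel, map_smul, adjoint_koopman_kernelFun]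

/-- With `k_z = K_z / ‖K_z‖`, the ratio is `‖𝓚* k_z‖² = ⟪k_z, 𝓚 𝓚* k_z⟫`. -/
theorem ratio_le (h : KoopmanBounded hσ φ) (z : Cn n) :
    h.ratio z ≤
      ‖h.toCLM (ContinuousLinearMap.adjoint h.toCLM (normalizedKernel hσ z))‖ := by
  set T := h.toCLM
  set k := normalizedKernel hσ z with hk
  have h1 : h.ratio z = ‖ContinuousLinearMap.adjoint T k‖ ^ 2 := by
    rw [ratio_eq, adjoint_koopman_normalizedKernel, norm_smul, Complex.norm_real, norm_inv,
      norm_norm, mul_pow, inv_pow, div_eq_inv_mul]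
  have h2 : ((‖ContinuousLinearMap.adjoint T k‖ ^ 2 : ℝ) : ℂ) =
      inner ℂ k (T (ContinuousLinearMap.adjoint T k)) := by
    rw [← ContinuousLinearMap.adjoint_inner_left, inner_self_eq_norm_sq_to_K]
    simp
  have h3 := congrArg norm h2
  rw [Complex.norm_real, Real.norm_of_nonneg (by positivity)] at h3
  rw [h1, h3]
  refine (norm_inner_le_norm _ _).trans_eq ?_
  rw [hk, norm_normalizedKernel, one_mul]

/-- The values of `𝓚 𝓚* k_z`, for the normalized kernel functions `k_z`, tend to zero because
`K_{φ w}(φ z)` is of exponential type zero in `z` while `‖K_z‖` grows exponentially. -/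
theorem tendsto_koopman_adjoint_normalizedKernel_apply (h : KoopmanBounded hσ φ) {α β : ℝ}
    (hα : 0 ≤ α) (hφ : ∀ z, ‖φ z‖ ≤ α * ‖z‖ + β) (w : Cn n) :
    Tendsto (fun z => h.toCLM (ContinuousLinearMap.adjoint h.toCLM (normalizedKernel hσ z)) w)
      (Bornology.cobounded (Cn n)) (𝓝 0) := by
  -- this `a` makes `exp (a * ‖φ z‖)` grow at most like `exp (‖z‖ / (8 * σ))`, against the lower bound
  -- `exp (‖z‖ / (4 * σ))` for `‖K_z‖`
  set a : ℝ := (8 * σ * (α + 1))⁻¹ with ha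
  have hapos : 0 < a := by positivity
  obtain ⟨C, hC, hCle⟩ := exists_kernelFun_apply_le (hσ := hσ) (φ w) hapos
  obtain ⟨c, hc, hcle⟩ := exists_le_norm_kernelFun hσ n
  have hlim : Tendsto (fun z : Cn n => c⁻¹ * C * Real.exp (a * β) *
      Real.exp (-((8 * σ)⁻¹ * ‖z‖))) (Bornology.cobounded (Cn n)) (𝓝 0) := by
    have h1 : Tendsto (fun z : Cn n => (8 * σ)⁻¹ * ‖z‖) (Bornology.cobounded (Cn n)) atTop :=
      tendsto_norm_cobounded_atTop.const_mul_atTop (by positivity)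
    simpa using (Real.tendsto_exp_neg_atTop_nhds_zero.comp h1).const_mul
      (c⁻¹ * C * Real.exp (a * β))
  refine squeeze_zero_norm (fun z => ?_) hlim
  rw [h.toCLM_apply, adjoint_koopman_normalizedKernel, RKHS.coe_smul, Pi.smul_apply, norm_smul,
    Complex.norm_real, norm_inv, norm_norm, kernelFun_apply_symm, RCLike.norm_conj]
  have haα : a * α ≤ (8 * σ)⁻¹ := by
    rw [ha, mul_inv, mul_assoc]
    refine mul_le_of_le_one_right (by positivity) ?_
    rw [inv_mul_le_iff₀ (by positivity)]
    linarith
  calc ‖kernelFun hσ z‖⁻¹ * ‖kernelFun hσ (φ w) (φ z)‖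
      ≤ (c * Real.exp (‖z‖ / (4 * σ)))⁻¹ * (C * Real.exp (a * (α * ‖z‖ + β))) := by
        gcongr
        · exact hcle z
        · exact (hCle _).trans (by gcongr; exact hφ z)
    _ = c⁻¹ * C * Real.exp (a * β) * Real.exp (a * α * ‖z‖ - ‖z‖ / (4 * σ)) := by
        rw [mul_inv, ← Real.exp_neg, mul_add, Real.exp_add, sub_eq_add_neg, Real.exp_add]
        ring_nf
    _ ≤ _ := by
        gcongr
        have h2 : ‖z‖ / (4 * σ) = 2 * ((8 * σ)⁻¹ * ‖z‖) := by field_simp; ring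
        rw [h2]
        nlinarith [norm_nonneg z]

/-- The functions `𝓚 𝓚* k_z` stay in a compact set, and their only cluster point is `0` because they
tend to zero pointwise. -/
theorem tendsto_ratio_of_isCompactOperator (h : KoopmanBounded hσ φ) {α β : ℝ}
    (hα : 0 ≤ α) (hφ : ∀ z, ‖φ z‖ ≤ α * ‖z‖ + β) (hT : IsCompactOperator h.toCLM) :
    Tendsto h.ratio (Bornology.cobounded (Cn n)) (𝓝 0) := by
  set T := h.toCLM
  have hS : IsCompactOperator (T ∘L ContinuousLinearMap.adjoint T) :=
    hT.comp_clm (ContinuousLinearMap.adjoint T)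
  obtain ⟨K, hK, hKS⟩ := hS.image_closedBall_subset_compact
    (f := ((T ∘L ContinuousLinearMap.adjoint T : Space n hσ →L[ℂ] Space n hσ) :
      Space n hσ →ₗ[ℂ] Space n hσ)) 1
  have hlim : Tendsto (fun z => T (ContinuousLinearMap.adjoint T (normalizedKernel hσ z)))
      (Bornology.cobounded (Cn n)) (𝓝 0) := by
    refine hK.tendsto_nhds_of_unique_mapClusterPt (Eventually.of_forall fun z => hKS
      ⟨normalizedKernel hσ z, by simp [norm_normalizedKernel], rfl⟩) fun y _ hy => ?_
    ext w
    have h1 : MapClusterPt (y w) (Bornology.cobounded (Cn n))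
        (fun z => T (ContinuousLinearMap.adjoint T (normalizedKernel hσ z)) w) :=
      hy.continuousAt_comp (RKHS.continuous_eval w).continuousAt
    have h2 := tendsto_koopman_adjoint_normalizedKernel_apply h hα hφ w
    have : (𝓝 (y w) ⊓ 𝓝 (0 : ℂ)).NeBot := h1.neBot.mono (inf_le_inf_left _ h2)
    exact eq_of_nhds_neBot this
  exact squeeze_zero (fun z => by rw [ratio_eq]; positivity) (ratio_le h)
    (by simpa using hlim.norm)

/-- If `‖L v‖ ≥ ‖v‖` for some `v ≠ 0`, then, up to the sign of `v`, `‖φ (t • v)‖ ≥ ‖t • v‖` for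
`t ≥ 0`, and monotonicity of the kernel makes the ratio at least `1` on this ray. -/
theorem norm_lt_of_tendsto_ratio (h : KoopmanBounded hσ φ) (L : Cn n →L[ℂ] Cn n) (B : Cn n)
    (hφ : ∀ z, φ z = L z + B) (hlim : Tendsto h.ratio (Bornology.cobounded (Cn n)) (𝓝 0))
    {v : Cn n} (hv : v ≠ 0) : ‖L v‖ < ‖v‖ := by
  by_contra! hle
  obtain ⟨u, hu, hule, hre⟩ : ∃ u : Cn n, u ≠ 0 ∧ ‖u‖ ≤ ‖L u‖ ∧ 0 ≤ (inner ℂ (L u) B).re := by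
    rcases le_total 0 (inner ℂ (L v) B).re with h0 | h0
    · exact ⟨v, hv, hle, h0⟩
    · exact ⟨-v, neg_ne_zero.2 hv, by simpa using hle, by simpa using h0⟩
  have hray : Tendsto (fun t : ℝ => (t : ℂ) • u) atTop (Bornology.cobounded (Cn n)) := by
    rw [← tendsto_norm_atTop_iff_cobounded]
    simp only [norm_smul, Complex.norm_real]
    exact (tendsto_norm_atTop_atTop).atTop_mul_const (norm_pos_iff.2 hu)
  have hge : ∀ᶠ t : ℝ in atTop, 1 ≤ h.ratio ((t : ℂ) • u) := by
    filter_upwards [eventually_ge_atTop 0] with t ht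
    rw [ratio_eq, one_le_div (by have := norm_kernelFun_pos (hσ := hσ) ((t : ℂ) • u); positivity)]
    gcongr
    refine norm_kernelFun_mono ?_
    refine le_of_sq_le_sq ?_ (norm_nonneg _)
    rw [hφ, map_smul, norm_add_sq (𝕜 := ℂ), norm_smul, norm_smul, inner_smul_left,
      Complex.conj_ofReal, mul_pow, mul_pow]
    have h1 : ‖u‖ ^ 2 ≤ ‖L u‖ ^ 2 := by gcongr
    have h2 : RCLike.re ((t : ℂ) * inner ℂ (L u) B) = t * (inner ℂ (L u) B).re := by
      simp
    rw [h2]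
    have h3 := mul_le_mul_of_nonneg_left h1 (sq_nonneg ‖(t : ℂ)‖)
    have h4 := mul_nonneg ht hre
    nlinarith [sq_nonneg ‖B‖]
  exact absurd (ge_of_tendsto (hlim.comp hray) hge) (by norm_num)

end Koopman

end Laplace

/-! ### A criterion for compactness -/

/-- A bounded operator on a Hilbert space which is small on the orthogonal complements of
finite-dimensional subspaces is a norm limit of operators of finite rank. -/
theorem isCompactOperator_of_forall_exists_orthogonal {H : Type*} [NormedAddCommGroup H]
    [InnerProductSpace ℂ H] [CompleteSpace H] (T : H →L[ℂ] H)
    (h : ∀ ε > 0, ∃ V : Submodule ℂ H, FiniteDimensional ℂ V ∧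
      ∀ f ∈ Vᗮ, ‖T f‖ ≤ ε * ‖f‖) : IsCompactOperator T := by
  have hcl : T ∈ closure {S : H →L[ℂ] H | IsCompactOperator S} := by
    rw [Metric.mem_closure_iff]
    intro ε hε
    obtain ⟨V, hV, hTV⟩ := h (ε / 2) (by positivity)
    refine ⟨T ∘L V.subtypeL ∘L V.orthogonalProjectionOnto, ?_, ?_⟩
    · have h1 : IsCompactOperator V.orthogonalProjectionOnto :=
        isCompactOperator_of_locallyCompactSpace_dom _
      exact h1.clm_comp (T ∘L V.subtypeL)
    · refine lt_of_le_of_lt ?_ (half_lt_self hε)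
      rw [dist_eq_norm]
      refine ContinuousLinearMap.opNorm_le_bound _ (by positivity) fun f => ?_
      have h1 : (T - T ∘L V.subtypeL ∘L V.orthogonalProjectionOnto) f =
          T (f - V.starProjection f) := by
        simp
      rw [h1]
      refine (hTV _ (V.sub_starProjection_mem_orthogonal f)).trans ?_
      gcongr
      rw [← Submodule.starProjection_orthogonal_val]
      exact Submodule.norm_starProjection_apply_le _ f
  rwa [isClosed_setOfPred_isCompactOperator.closure_eq] at hcl

/-! ### Compactness for contractive symbols -/

namespace Laplace

section Koopman

variable {n : ℕ} {σ : ℝ} {hσ : 0 < σ} {φ : Cn n → Cn n}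

/-- A bounded sequence in `H` whose members vanish at more and more points of a dense sequence tends
to zero pointwise, since bounded sets in `H` are equicontinuous. -/
theorem tendsto_apply_of_vanish_on_dense {f : ℕ → Space n hσ} (hf : ∀ m, ‖f m‖ ≤ 1)
    {w : ℕ → Cn n} (hw : DenseRange w) (hfw : ∀ m, ∀ i < m, f m (w i) = 0) (z : Cn n) :
    Tendsto (fun m => f m z) atTop (𝓝 0) := by
  obtain ⟨C, hC, h⟩ := exists_fderiv_bound (n := n) hσ (‖z‖ + 1)
  rw [Metric.tendsto_atTop]
  intro ε hε
  obtain ⟨i, hi⟩ := hw.exists_dist_lt z (ε := min 1 (ε / (C + 1))) (by positivity)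
  have hi1 := hi.trans_le (min_le_left _ _)
  have hi2 := hi.trans_le (min_le_right _ _)
  rw [lt_div_iff₀ (by positivity), dist_eq_norm] at hi2
  refine ⟨i + 1, fun m hm => ?_⟩
  have h1 := (convex_ball z 1).norm_image_sub_le_of_norm_fderiv_le (𝕜 := ℂ) (f := (f m : Cn n → ℂ))
    (C := C) (fun x _ => Space.differentiable hσ (f m) x) (fun x hx => by
      refine (h (f m) x ?_).trans (mul_le_of_le_one_right hC (hf m))
      rw [mem_ball, dist_eq_norm] at hx
      linarith [norm_le_norm_add_norm_sub' x z])
    (mem_ball'.2 hi1) (mem_ball_self one_pos)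
  rw [hfw m i (by omega), sub_zero] at h1
  rw [dist_zero_right]
  calc ‖f m z‖ ≤ C * ‖z - w i‖ := h1
    _ ≤ ‖z - w i‖ * (C + 1) := by nlinarith [norm_nonneg (z - w i)]
    _ < ε := hi2

/-- When `φ` is a contraction up to an additive constant, `‖f (φ z)‖² exp (-‖z‖ / σ)` is dominated
by an integrable function uniformly over the unit ball of `H`, so that `𝓚` turns pointwise into norm
convergence. -/
theorem tendsto_norm_koopman (h : KoopmanBounded hσ φ) {a b : ℝ} (ha : a < 1)
    (hφ : ∀ z, ‖φ z‖ ≤ a * ‖z‖ + b) {f : ℕ → Space n hσ} (hf : ∀ m, ‖f m‖ ≤ 1)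
    (hlim : ∀ z, Tendsto (fun m => f m z) atTop (𝓝 0)) :
    Tendsto (fun m => ‖h.toCLM (f m)‖) atTop (𝓝 0) := by
  obtain ⟨C, hC, hK⟩ := exists_norm_kernelFun_le hσ n
  have hdom : Integrable (fun z : Cn n => C ^ 2 * Real.exp (b / σ) *
      Real.exp (-((1 - a) / σ * ‖z‖))) (lebesgue n) :=
    (integrable_exp_neg_mul_norm (div_pos (sub_pos.2 ha) hσ)).const_mul _
  have hint : Tendsto (fun m => ∫ z, ‖h.toCLM (f m) z‖ ^ 2 * Real.exp (-‖z‖ / σ) ∂(lebesgue n))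
      atTop (𝓝 (∫ _, (0 : ℝ) ∂(lebesgue n))) := by
    refine tendsto_integral_of_dominated_convergence _
      (fun m => (integrable_norm_sq_mul_exp _).aestronglyMeasurable) hdom
      (fun m => Eventually.of_forall fun z => ?_) (Eventually.of_forall fun z => ?_)
    · rw [Real.norm_of_nonneg (by positivity), h.toCLM_apply]
      have h1 : ‖f m (φ z)‖ ≤ C * Real.exp ((a * ‖z‖ + b) / (2 * σ)) := by
        refine (norm_apply_le (f m) (φ z)).trans
          ((mul_le_of_le_one_right (norm_nonneg _) (hf m)).trans ((hK _).trans ?_))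
        gcongr
        exact hφ z
      calc ‖f m (φ z)‖ ^ 2 * Real.exp (-‖z‖ / σ)
          ≤ (C * Real.exp ((a * ‖z‖ + b) / (2 * σ))) ^ 2 * Real.exp (-‖z‖ / σ) := by gcongr
        _ = C ^ 2 * Real.exp (b / σ + -((1 - a) / σ * ‖z‖)) := by
          rw [mul_pow, ← Real.exp_nat_mul, mul_assoc, ← Real.exp_add]
          congr 2
          push_cast
          field_simp
          ring
        _ = _ := by rw [Real.exp_add, mul_assoc]
    · simp only [h.toCLM_apply]
      simpa using ((hlim (φ z)).norm.pow 2).mul_const (Real.exp (-‖z‖ / σ))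
  have hsq : Tendsto (fun m => ‖h.toCLM (f m)‖ ^ 2) atTop (𝓝 0) := by
    simp_rw [Space.norm_sq_eq]
    simpa using hint.const_mul ((2 * Real.pi * σ ^ 2) ^ n)⁻¹
  simpa [Real.sqrt_sq] using hsq.sqrt

/-- If `𝓚` were not small on the functions vanishing at the first `m` points of a dense sequence, for
any `m`, then unit vectors witnessing this would tend to zero pointwise but not in norm under `𝓚`. -/
theorem isCompactOperator_of_norm_le (h : KoopmanBounded hσ φ) {a b : ℝ} (ha : a < 1)
    (hφ : ∀ z, ‖φ z‖ ≤ a * ‖z‖ + b) : IsCompactOperator h.toCLM := by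
  refine isCompactOperator_of_forall_exists_orthogonal _ fun ε hε => ?_
  by_contra! hcon
  set w := TopologicalSpace.denseSeq (Cn n)
  set V : ℕ → Submodule ℂ (Space n hσ) := fun m =>
    Submodule.span ℂ ((fun i => kernelFun hσ (w i)) '' Set.Iio m) with hV
  have hfin : ∀ m, FiniteDimensional ℂ (V m) := fun m =>
    FiniteDimensional.span_of_finite ℂ ((Set.finite_Iio m).image _)
  choose g hgV hg using fun m => hcon (V m) (hfin m)
  have hg0 : ∀ m, 0 < ‖g m‖ := fun m => by
    rw [norm_pos_iff]
    intro h0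
    simpa [h0] using hg m
  set f : ℕ → Space n hσ := fun m => ((‖g m‖⁻¹ : ℝ) : ℂ) • g m with hfdef
  have hf1 : ∀ m, ‖f m‖ ≤ 1 := fun m => by
    simp only [hfdef, norm_smul, Complex.norm_real, norm_inv, norm_norm]
    rw [inv_mul_cancel₀ (hg0 m).ne']
  have hfT : ∀ m, ε ≤ ‖h.toCLM (f m)‖ := fun m => by
    simp only [hfdef, map_smul, norm_smul, Complex.norm_real, norm_inv, norm_norm]
    rw [le_inv_mul_iff₀ (hg0 m), mul_comm]
    exact (hg m).le
  have hfw : ∀ m, ∀ i < m, f m (w i) = 0 := fun m i hi => by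
    have hmem : kernelFun hσ (w i) ∈ V m :=
      Submodule.subset_span (Set.mem_image_of_mem (fun i => kernelFun hσ (w i)) hi)
    have h0 : inner ℂ (kernelFun hσ (w i)) (g m) = 0 :=
      Submodule.inner_right_of_mem_orthogonal hmem (hgV m)
    rw [← inner_kernelFun hσ (w i) (f m), inner_smul_right, h0, mul_zero]
  have hlim := tendsto_norm_koopman h ha hφ hf1
    (tendsto_apply_of_vanish_on_dense hf1 (TopologicalSpace.denseRange_denseSeq _) hfw)
  exact absurd (ge_of_tendsto' hlim hfT) (not_le.2 hε)

end Koopman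

end Laplace

/-! ### Compactness and the ratio for affine symbols -/

/-- In finite dimension, a linear map that shortens every nonzero vector does so by a uniform
factor. -/
theorem exists_norm_le_mul_of_norm_lt {E : Type*} [NormedAddCommGroup E] [NormedSpace ℂ E]
    [FiniteDimensional ℂ E] (L : E →L[ℂ] E) (h : ∀ v ≠ 0, ‖L v‖ < ‖v‖) :
    ∃ a < 1, ∀ v, ‖L v‖ ≤ a * ‖v‖ := by
  have : ProperSpace E := FiniteDimensional.proper ℂ E
  rcases subsingleton_or_nontrivial E with hE | hE
  · exact ⟨0, one_pos, fun v => by simp [Subsingleton.elim v 0]⟩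
  have : NormedSpace ℝ E := NormedSpace.complexToReal
  obtain ⟨v, hv, hmax⟩ := (isCompact_sphere (0 : E) 1).exists_isMaxOn
    (NormedSpace.sphere_nonempty.2 zero_le_one) (f := fun v => ‖L v‖) (by fun_prop)
  have hv1 : ‖v‖ = 1 := by simpa using hv
  have hv0 : v ≠ 0 := by
    rintro rfl
    simp at hv1
  refine ⟨‖L v‖, hv1 ▸ h v hv0, fun x => ?_⟩
  rcases eq_or_ne x 0 with rfl | hx
  · simp
  have hx' := norm_pos_iff.2 hx
  have h1 : ‖L (((‖x‖⁻¹ : ℝ) : ℂ) • x)‖ ≤ ‖L v‖ := hmax (by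
    rw [mem_sphere_zero_iff_norm, norm_smul, Complex.norm_real, norm_inv, norm_norm,
      inv_mul_cancel₀ hx'.ne'])
  rw [map_smul, norm_smul, Complex.norm_real, norm_inv, norm_norm, inv_mul_le_iff₀ hx'] at h1
  linarith

theorem mainTheorem2 (n : ℕ) (σ : ℝ) (hσ : 0 < σ)
    (φ : Cn n → Cn n) (hφ : Differentiable ℂ φ)
    (A : Matrix (Fin n) (Fin n) ℂ) (B : Cn n) (hA : A ≠ 0) (hAinv : IsUnit A)
    (hφAB : ∀ z : Cn n, φ z = WithLp.toLp 2 (A *ᵥ z.ofLp) + B)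
    (hb : Laplace.KoopmanBounded hσ φ) :
    IsCompactOperator hb.toCLM ↔
      Tendsto (fun z : Cn n => hb.ratio z) (Bornology.cobounded (Cn n)) (𝓝 0) := by
  let L : Cn n →L[ℂ] Cn n := (Matrix.toEuclideanLin A).toContinuousLinearMap
  have hL : ∀ z, φ z = L z + B := hφAB
  constructor
  · refine Laplace.tendsto_ratio_of_isCompactOperator hb (norm_nonneg L) (β := ‖B‖) fun z => ?_
    rw [hL]
    exact (norm_add_le _ _).trans (by gcongr; exact L.le_opNorm z)
  · intro hlim
    obtain ⟨a, ha, hLa⟩ := exists_norm_le_mul_of_norm_lt L fun v hv =>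
      Laplace.norm_lt_of_tendsto_ratio hb L B hL hlim hv
    refine Laplace.isCompactOperator_of_norm_le hb ha (b := ‖B‖) fun z => ?_
    rw [hL]
    exact (norm_add_le _ _).trans (by gcongr; exact hLa z)
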